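/- Let $\mathsf{BPMet}$ be the category of pseudometric spaces with distances in $[0,1]$ and non-expansive maps. Let $F\colon\mathsf{BPMet}\to\mathsf{BPMet}$ be a functor that - preserves isometries (i.e. distance-preserving, not necessarily injective, maps); - is locally non-expansive: $\sup_{t\in FX}d(Ff(t),Fg(t))\le\sup_{x\in X}d(f(x),g(x))$ for all non-expansive $f,g\colon X\to Y$ (suprema in $[0,1]$); - admits a dense $\omega$-bounded subfunctor: there are a functor $F_0\colon\mathsf{BPMet}\to\mathsf{BPMet}$ and a componentwise injective natural transformation $\iota\colon F_0\to F$ such that every $\iota_X(F_0X)$ is dense in $FX$, and such that for every $X$ and $t\in F_0X$ there are a finite subspace $i\colon X_0\hookrightarrow X$ and $t'\in F_0X_0$ with $t=F_0i(t')$. An $n$-ary predicate lifting for $F$ ($n\in\mathbb N$) is a natural transformation $\lambda\colon\mathsf{BPMet}(-,[0,1]^n)\to\mathsf{BPMet}(F-,[0,1])$, where $[0,1]$ carries the distance $|u-v|$ and $[0,1]^n$ the supremum distance. For a set $\Lambda$ of predicate liftings of finite arity, the formulas of the logic $\mathcal L(\Lambda)$ are given by $$\phi::=\top\mid\phi_1\vee\phi_2\mid\phi_1\wedge\phi_2\mid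 u\otimes\phi\mid\hom_s(u,\phi)\mid\lambda(\phi_1,\dots,\phi_n)\qquad(u\in[0,1],\ \lambda\in\Lambda\ n\text{-ary}).$$ Over a coalgebra $\alpha\colon X\to FX$ (a morphism of $\mathsf{BPMet}$), a formula $\phi$ is interpreted as a non-expansive map $[\![\phi]\!]_\alpha\colon X\to[0,1]$: $\top$ is the constant $0$, $\vee$ and $\wedge$ are the pointwise minimum and maximum of real numbers (truth values are ordered by $\ge$), $u\otimes\phi$ is $\min(u+[\![\phi]\!]_\alpha,1)$, $\hom_s(u,\phi)$ is $|u-[\![\phi]\!]_\alpha|$, and $[\![\lambda(\phi_1,\dots,\phi_n)]\!]_\alpha=\lambda_X(\langle[\![\phi_1]\!]_\alpha,\dots,[\![\phi_n]\!]_\alpha\rangle)\circ\alpha$. Then there is a set $\Lambda$ of predicate liftings for $F$ of finite arity such that $\mathcal L(\Lambda)$ is expressive: for every $F$-coalgebra $(X,\alpha)$ and all $x,y\in X$, logical distance equals behavioural distance, $$\sup_{\phi\in\mathcal L(\Lambda)}\bigl|[\![\phi]\!]_\alpha(x)-[\![\phi]\!]_\alpha(y)\bigr|=\inf\bigl\{d_Y(f(x),f(y))\bigm|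 f\colon(X,\alpha)\to(Y,\beta)\text{ a coalgebra morphism}\bigr\}.$$ -/

import Mathlib

open CategoryTheory

universe u v w

noncomputable section

/-! ### Non-expansive maps -/

/-- Non-expansive maps between pseudometric spaces. -/
structure NonexpMap (X : Type u) (Y : Type v) [PseudoMetricSpace X] [PseudoMetricSpace Y] where
  toFun : X → Y
  nonexpansive : LipschitzWith 1 toFun

namespace NonexpMap

variable {X : Type u} {Y : Type v} {Z : Type w}
  [PseudoMetricSpace X] [PseudoMetricSpace Y] [PseudoMetricSpace Z]

instance : FunLike (NonexpMap X Y) X Y where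
  coe := NonexpMap.toFun
  coe_injective := by
    rintro ⟨f, hf⟩ ⟨g, hg⟩ h
    cases h
    rfl

@[ext] theorem ext {f g : NonexpMap X Y} (h : ∀ x, f x = g x) : f = g :=
  DFunLike.ext f g h

theorem dist_le (f : NonexpMap X Y) (x y : X) : dist (f x) (f y) ≤ dist x y := by
  simpa using LipschitzWith.dist_le_mul (f := f) f.nonexpansive x y

/-- Build a non-expansive map from the defining inequality of distances. -/
def ofDist (f : X → Y) (h : ∀ x y, dist (f x) (f y) ≤ dist x y) : NonexpMap X Y :=
  ⟨f, LipschitzWith.of_dist_le_mul (by simpa using h)⟩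

/-- The identity map. -/
def id (X : Type u) [PseudoMetricSpace X] : NonexpMap X X := ⟨fun x => x, LipschitzWith.id⟩

/-- `g.comp f` is the map `x ↦ g (f x)`. -/
def comp (g : NonexpMap Y Z) (f : NonexpMap X Y) : NonexpMap X Z :=
  ofDist (fun x => g (f x)) fun x y => (g.dist_le _ _).trans (f.dist_le x y)

/-- The tupling `⟨f₁, …, fₙ⟩ : X → Yⁿ`, where the power `Yⁿ` carries the supremum distance. -/
def tuple {n : ℕ} (f : Fin n → NonexpMap X Y) : NonexpMap X (Fin n → Y) :=
  ofDist (fun x i => f i x) fun x y =>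
    (dist_pi_le_iff dist_nonneg).2 fun i => (f i).dist_le x y

/-- The supremum distance between two non-expansive maps (used only for codomains of diameter at
most `1`, so that the supremum is that of a bounded family; it is `0` on an empty domain). -/
def supDist (f g : NonexpMap X Y) : ℝ := ⨆ x, dist (f x) (g x)

end NonexpMap

/-! ### The category of pseudometric spaces bounded by 1 -/

/-- A pseudometric space all of whose distances are at most `1`. -/
structure BPMet : Type (u + 1) where
  carrier : Type u
  [pseudoMetric : PseudoMetricSpace carrier]
  dist_le_one : ∀ x y : carrier, dist x y ≤ 1

namespace BPMet

instance : CoeSort BPMet.{u} (Type u) := ⟨BPMet.carrier⟩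

instance (X : BPMet.{u}) : PseudoMetricSpace X := X.pseudoMetric

/-- Morphisms are the non-expansive maps. -/
instance : Category.{u} BPMet.{u} where
  Hom X Y := NonexpMap X Y
  id X := NonexpMap.id X
  comp f g := NonexpMap.comp g f

instance : ConcreteCategory BPMet.{u} (fun X Y => NonexpMap X Y) where
  hom f := f
  ofHom f := f

/-- The non-expansive map underlying a morphism. -/
abbrev toMap {X Y : BPMet.{u}} (f : X ⟶ Y) : NonexpMap X Y := ConcreteCategory.hom (C := BPMet.{u}) f

/-- A subset of a space, with the restricted distance. -/
def sub (X : BPMet.{u}) (S : Set X) : BPMet.{u} where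
  carrier := S
  dist_le_one x y := X.dist_le_one x y

/-- The inclusion of a subspace. -/
def incl (X : BPMet.{u}) (S : Set X) : X.sub S ⟶ X :=
  (⟨Subtype.val, LipschitzWith.subtype_val S⟩ : NonexpMap S X)

end BPMet

/-! ### Properties of functors -/

/-- `F` preserves isometries (distance-preserving maps, not necessarily injective). -/
def PreservesIsometries (F : BPMet.{u} ⥤ BPMet.{u}) : Prop :=
  ∀ (X Y : BPMet.{u}) (f : X ⟶ Y), Isometry f → Isometry (F.map f)

/-- `F` is non-expansive on hom-sets, with respect to the supremum distance. -/
def LocallyNonexpansive (F : BPMet.{u} ⥤ BPMet.{u}) : Prop :=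
  ∀ (X Y : BPMet.{u}) (f g : X ⟶ Y),
    NonexpMap.supDist (BPMet.toMap (F.map f)) (BPMet.toMap (F.map g)) ≤
      NonexpMap.supDist (BPMet.toMap f) (BPMet.toMap g)

/-- Every element of `F X` comes from a finite subspace of `X`. -/
def OmegaBounded (F : BPMet.{u} ⥤ BPMet.{u}) : Prop :=
  ∀ (X : BPMet.{u}) (t : F.obj X),
    ∃ S : Set X, S.Finite ∧ ∃ t' : F.obj (X.sub S), F.map (X.incl S) t' = t

/-- `F` has a subfunctor (a functor with a componentwise injective natural transformation to `F`)
that is `ω`-bounded and whose components have dense image. -/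
def HasDenseOmegaBoundedSubfunctor (F : BPMet.{u} ⥤ BPMet.{u}) : Prop :=
  ∃ (F₀ : BPMet.{u} ⥤ BPMet.{u}) (ι : F₀ ⟶ F),
    (∀ X : BPMet.{u}, Function.Injective (ι.app X)) ∧
    (∀ X : BPMet.{u}, DenseRange (ι.app X)) ∧
    OmegaBounded F₀

/-! ### Predicate liftings

The space of truth values is `unitInterval` with distance `|u - v|`; its powers
`Fin n → unitInterval` carry the supremum distance. -/

/-- A predicate lifting of finite arity for `F`: a natural transformation from
`BPMet(-, [0,1]ⁿ)` to `BPMet(F -, [0,1])`. -/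
structure PredicateLifting (F : BPMet.{u} ⥤ BPMet.{u}) : Type (u + 1) where
  arity : ℕ
  app : ∀ X : BPMet.{u},
    NonexpMap X (Fin arity → unitInterval) → NonexpMap (F.obj X) unitInterval
  natural : ∀ (X Y : BPMet.{u}) (h : X ⟶ Y) (f : NonexpMap Y (Fin arity → unitInterval)),
    app X (f.comp (BPMet.toMap h)) = (app Y f).comp (BPMet.toMap (F.map h))

/-! ### Quantitative coalgebraic modal logic

The quantale of truth values is `[0,1]` with the order opposite to the numeric one and with
truncated addition as tensor. So its top element is `0`, its joins are numeric minima, its meets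
are numeric maxima, and its symmetrized internal hom is `|u - v|`. -/

/-- Truncated addition on `[0,1]`. -/
def truncAdd (a b : unitInterval) : unitInterval :=
  ⟨min ((a : ℝ) + b) 1, le_min (add_nonneg a.2.1 b.2.1) zero_le_one, min_le_right _ _⟩

/-- The absolute difference on `[0,1]`. -/
def absDiff (a b : unitInterval) : unitInterval :=
  ⟨|(a : ℝ) - b|, abs_nonneg _,
    abs_le.2 ⟨by linarith [a.2.1, b.2.2], by linarith [a.2.2, b.2.1]⟩⟩

/-- Formulas over a set `Λ` of modalities. -/
inductive Formula {F : BPMet.{u} ⥤ BPMet.{u}} (Λ : Set (PredicateLifting F)) : Type (u + 1)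
  | top : Formula Λ
  | or (φ ψ : Formula Λ) : Formula Λ
  | and (φ ψ : Formula Λ) : Formula Λ
  | tensor (a : unitInterval) (φ : Formula Λ) : Formula Λ
  | homs (a : unitInterval) (φ : Formula Λ) : Formula Λ
  | modal (l : PredicateLifting F) (hl : l ∈ Λ) (φ : Fin l.arity → Formula Λ) : Formula Λ

namespace NonexpMap

variable {X : Type u} [PseudoMetricSpace X]

/-- The predicate that is constantly `0`. -/
def zero : NonexpMap X unitInterval := ofDist (fun _ => 0) fun x y => by simp

/-- Pointwise minimum of predicates. -/
def pmin (f g : NonexpMap X unitInterval) : NonexpMap X unitInterval :=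
  ofDist (fun x => min (f x) (g x)) fun x y => by
    have hf := f.dist_le x y
    have hg := g.dist_le x y
    rw [Subtype.dist_eq, Real.dist_eq] at hf hg ⊢
    have h := abs_min_sub_min_le_max (f x : ℝ) (g x) (f y) (g y)
    have e : ∀ z, ((min (f z) (g z) : unitInterval) : ℝ) = min (f z : ℝ) (g z) :=
      fun z => Monotone.map_min (Subtype.mono_coe _)
    rw [e, e]
    exact h.trans (max_le hf hg)

/-- Pointwise maximum of predicates. -/
def pmax (f g : NonexpMap X unitInterval) : NonexpMap X unitInterval :=
  ofDist (fun x => max (f x) (g x)) fun x y => by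
    have hf := f.dist_le x y
    have hg := g.dist_le x y
    rw [Subtype.dist_eq, Real.dist_eq] at hf hg ⊢
    have h := abs_max_sub_max_le_max (f x : ℝ) (g x) (f y) (g y)
    have e : ∀ z, ((max (f z) (g z) : unitInterval) : ℝ) = max (f z : ℝ) (g z) :=
      fun z => Monotone.map_max (Subtype.mono_coe _)
    rw [e, e]
    exact h.trans (max_le hf hg)

/-- Truncated addition of a constant to a predicate. -/
def padd (a : unitInterval) (f : NonexpMap X unitInterval) : NonexpMap X unitInterval :=
  ofDist (fun x => truncAdd a (f x)) fun x y => by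
    have hf := f.dist_le x y
    rw [Subtype.dist_eq, Real.dist_eq] at hf ⊢
    refine (abs_min_sub_min_le_max ((a : ℝ) + f x) 1 ((a : ℝ) + f y) 1).trans ?_
    simpa using hf

/-- Absolute difference of a constant and a predicate. -/
def pabs (a : unitInterval) (f : NonexpMap X unitInterval) : NonexpMap X unitInterval :=
  ofDist (fun x => absDiff a (f x)) fun x y => by
    have hf := f.dist_le x y
    rw [Subtype.dist_eq, Real.dist_eq] at hf ⊢
    refine (abs_abs_sub_abs_le_abs_sub ((a : ℝ) - f x) ((a : ℝ) - f y)).trans ?_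
    rw [abs_sub_comm] at hf
    simpa using hf

end NonexpMap

/-- The interpretation of a formula over a coalgebra `A = (X, α)`, a non-expansive predicate on
the state space `X`. -/
def sem {F : BPMet.{u} ⥤ BPMet.{u}} {Λ : Set (PredicateLifting F)}
    (A : Endofunctor.Coalgebra F) : Formula Λ → NonexpMap A.V unitInterval
  | .top => NonexpMap.zero
  | .or φ ψ => NonexpMap.pmin (sem A φ) (sem A ψ)
  | .and φ ψ => NonexpMap.pmax (sem A φ) (sem A ψ)
  | .tensor a φ => NonexpMap.padd a (sem A φ)
  | .homs a φ => NonexpMap.pabs a (sem A φ)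
  | .modal l _ φ =>
      (l.app A.V (NonexpMap.tuple fun i => sem A (φ i))).comp (BPMet.toMap A.str)

/-! ### Logical and behavioural distance -/

/-- Logical distance: the supremum over all formulas of the difference of truth values
(a non-empty family bounded by `1`). -/
def logicalDist {F : BPMet.{u} ⥤ BPMet.{u}} (Λ : Set (PredicateLifting F))
    (A : Endofunctor.Coalgebra F) (x y : A.V) : ℝ :=
  ⨆ φ : Formula Λ, dist (sem A φ x) (sem A φ y)

/-- Behavioural distance: the infimum, over all coalgebra morphisms `f` out of `A`, of the
distance of `f x` and `f y` (a non-empty set bounded below by `0`). -/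
def behaviouralDist {F : BPMet.{u} ⥤ BPMet.{u}}
    (A : Endofunctor.Coalgebra F) (x y : A.V) : ℝ :=
  sInf {r : ℝ | ∃ (B : Endofunctor.Coalgebra F) (f : A ⟶ B), r = dist (f.f x) (f.f y)}

/-- The logic over `Λ` is expressive: logical and behavioural distance agree on every
coalgebra. -/
def Expressive {F : BPMet.{u} ⥤ BPMet.{u}} (Λ : Set (PredicateLifting F)) : Prop :=
  ∀ (A : Endofunctor.Coalgebra F) (x y : A.V), logicalDist Λ A x y = behaviouralDist A x y

end

noncomputable section

/-! ### Cubes and distance predicates -/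

namespace BPMet

/-! Take all predicate liftings of finite arity. Coalgebra morphisms preserve formulas, so logical
distance is at most behavioural distance. For the converse, let `L` be the state space with logical
distance; if the structure map descends to `L`, the identity-on-points map to `L` is a coalgebra
morphism attaining logical distance.

Descent is `dist_map_str_le_logicalDist`. Two elements of `F L` nearly come from a finite subspace
`S`. Distances to the points of `S` embed it isometrically in a cube, and formulas approximate these
distances on `S` (`exists_formula_approx`), giving a map from `L` to the cube. Preservation of
isometries and local non-expansiveness make `F` of that map almost distance-preserving on the two
elements (`dist_le_dist_map_add`). One modality, a distance predicate on `F` of the cube, then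
separates them. -/

theorem map_comp_apply (F : BPMet.{u} ⥤ BPMet.{u}) {X Y Z : BPMet.{u}} (f : X ⟶ Y) (g : Y ⟶ Z)
    (t : F.obj X) : F.map (f ≫ g) t = F.map g (F.map f t) := by
  rw [F.map_comp]; rfl

theorem hom_dist_le {X Y : BPMet.{u}} (f : X ⟶ Y) (x y : X) : dist (f x) (f y) ≤ dist x y :=
  NonexpMap.dist_le (toMap f) x y

/-- The power `[0,1]ⁿ` with the supremum distance, as an object of the category. -/
def cube (n : ℕ) : BPMet.{u} where
  carrier := ULift.{u} (Fin n → unitInterval)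
  dist_le_one x y := (dist_pi_le_iff zero_le_one).2 fun i =>
    (Subtype.dist_eq _ _).trans_le (Real.dist_le_of_mem_Icc_01 (x.down i).2 (y.down i).2)

/-- Predicates of arity `n` as morphisms into the cube. -/
def toCube {X : BPMet.{u}} {n : ℕ} (f : NonexpMap X (Fin n → unitInterval)) : X ⟶ cube.{u} n :=
  NonexpMap.ofDist (Y := cube.{u} n) (fun x => ULift.up (f x)) fun x y => f.dist_le x y

/-- The tautological predicate on the cube. -/
def ofCube (n : ℕ) : NonexpMap (cube.{u} n) (Fin n → unitInterval) :=
  NonexpMap.ofDist (X := cube.{u} n) ULift.down fun _ _ => le_rfl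

/-- The distance from a given point, as a predicate. -/
def distFrom {X : BPMet.{u}} (z : X) : NonexpMap X unitInterval :=
  NonexpMap.ofDist (fun x => ⟨dist x z, dist_nonneg, X.dist_le_one x z⟩) fun x y => by
    rw [Subtype.dist_eq, Real.dist_eq]
    exact abs_dist_sub_le x y z

end BPMet

/-! ### Predicate liftings via Yoneda -/

open BPMet

/-- The predicate lifting that corresponds, by the Yoneda lemma, to a predicate on `F [0,1]ⁿ`. -/
def PredicateLifting.ofPred (F : BPMet.{u} ⥤ BPMet.{u}) (n : ℕ)
    (e : NonexpMap (F.obj (cube.{u} n)) unitInterval) : PredicateLifting F where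
  arity := n
  app X f := e.comp (toMap (F.map (toCube f)))
  natural X Y h f := by
    refine NonexpMap.ext fun t => ?_
    exact congrArg e (map_comp_apply F h (toCube f) t)

/-- Every predicate is the tautological one pulled back along `toCube f`. -/
theorem PredicateLifting.app_eq {F : BPMet.{u} ⥤ BPMet.{u}} (l : PredicateLifting F)
    (X : BPMet.{u}) (f : NonexpMap X (Fin l.arity → unitInterval)) :
    l.app X f = (l.app _ (ofCube l.arity)).comp (toMap (F.map (toCube f))) :=
  l.natural _ _ (toCube f) (ofCube l.arity)

/-- By Yoneda, a lifting is determined by its arity and one predicate on `F` of a cube, and these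
data live in `Type u`. -/
instance PredicateLifting.small (F : BPMet.{u} ⥤ BPMet.{u}) :
    Small.{u} (PredicateLifting F) := by
  let G : PredicateLifting F → Σ n : ℕ, NonexpMap (F.obj (cube.{u} n)) unitInterval :=
    fun l => ⟨l.arity, l.app _ (ofCube l.arity)⟩
  refine small_of_injective (f := G) ?_
  rintro l l' h
  have hl := l.app_eq
  have hl' := l'.app_eq
  obtain ⟨n, a, ha⟩ := l
  obtain ⟨n', a', ha'⟩ := l'
  obtain rfl : n = n' := congrArg Sigma.fst h
  have h2 : a _ (ofCube n) = a' _ (ofCube n) := eq_of_heq (Sigma.mk.inj h).2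
  congr 1
  funext X f
  exact (hl X f).trans ((congrArg (fun e => NonexpMap.comp e _) h2).trans (hl' X f).symm)

/-! ### Formulas and logical distance -/

section Semantics

variable {F : BPMet.{u} ⥤ BPMet.{u}} {Λ : Set (PredicateLifting F)}

/-- Coalgebra morphisms preserve the interpretation of formulas. -/
theorem sem_hom {A B : Endofunctor.Coalgebra F} (f : A ⟶ B) (φ : Formula Λ) (x : A.V) :
    sem A φ x = sem B φ (f.f x) := by
  induction φ generalizing x with
  | top => rfl
  | or φ ψ h₁ h₂ => exact congrArg₂ min (h₁ x) (h₂ x)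
  | and φ ψ h₁ h₂ => exact congrArg₂ max (h₁ x) (h₂ x)
  | tensor a φ h => exact congrArg (truncAdd a) (h x)
  | homs a φ h => exact congrArg (absDiff a) (h x)
  | modal l hl φ h =>
    have e : NonexpMap.tuple (fun i => sem A (φ i)) =
        (NonexpMap.tuple fun i => sem B (φ i)).comp (toMap f.f) := by
      ext y : 1
      funext i
      exact h i y
    have hf : F.map f.f (A.str x) = B.str (f.f x) :=
      congrArg (fun g : A.V ⟶ F.obj B.V => g x) f.h
    change l.app A.V _ (A.str x) = l.app B.V _ (B.str (f.f x))
    rw [e, l.natural, ← hf]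
    rfl

instance : Nonempty (Formula Λ) := ⟨.top⟩

theorem bddAbove_logical (Λ : Set (PredicateLifting F)) (A : Endofunctor.Coalgebra F)
    (x y : A.V) : BddAbove (Set.range fun φ : Formula Λ => dist (sem A φ x) (sem A φ y)) :=
  ⟨dist x y, by rintro _ ⟨φ, rfl⟩; exact (sem A φ).dist_le x y⟩

theorem dist_sem_le_logicalDist (A : Endofunctor.Coalgebra F) (φ : Formula Λ) (x y : A.V) :
    dist (sem A φ x) (sem A φ y) ≤ logicalDist Λ A x y :=
  le_ciSup (bddAbove_logical Λ A x y) φ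

theorem logicalDist_le_dist (Λ : Set (PredicateLifting F)) (A : Endofunctor.Coalgebra F)
    (x y : A.V) : logicalDist Λ A x y ≤ dist x y :=
  ciSup_le fun φ => (sem A φ).dist_le x y

theorem logicalDist_le_behaviouralDist (Λ : Set (PredicateLifting F))
    (A : Endofunctor.Coalgebra F) (x y : A.V) : logicalDist Λ A x y ≤ behaviouralDist A x y := by
  refine le_csInf ⟨_, A, 𝟙 A, rfl⟩ ?_
  rintro _ ⟨B, f, rfl⟩
  refine ciSup_le fun φ => ?_
  rw [sem_hom f, sem_hom f]
  exact (sem B φ).dist_le _ _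

/-- The state space of a coalgebra, equipped with logical distance. -/
def logicalSpace (Λ : Set (PredicateLifting F)) (A : Endofunctor.Coalgebra F) : BPMet.{u} where
  carrier := A.V
  pseudoMetric :=
    { dist := logicalDist Λ A
      dist_self := fun x => by simp [logicalDist]
      dist_comm := fun x y => by simp only [logicalDist, dist_comm]
      dist_triangle := fun x y z => ciSup_le fun φ => (dist_triangle _ (sem A φ y) _).trans
        (add_le_add (dist_sem_le_logicalDist A φ x y) (dist_sem_le_logicalDist A φ y z)) }
  dist_le_one x y := (logicalDist_le_dist Λ A x y).trans (A.V.dist_le_one x y)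

/-- The identity map from the state space to the state space under logical distance. -/
def toLogicalSpace (Λ : Set (PredicateLifting F)) (A : Endofunctor.Coalgebra F) :
    A.V ⟶ logicalSpace Λ A :=
  NonexpMap.ofDist (Y := logicalSpace Λ A) (fun x => x) fun x y => logicalDist_le_dist Λ A x y

/-- The interpretation of a formula is non-expansive with respect to logical distance. -/
def semLogical (A : Endofunctor.Coalgebra F) (φ : Formula Λ) :
    NonexpMap (logicalSpace Λ A) unitInterval :=
  NonexpMap.ofDist (X := logicalSpace Λ A) (fun x => sem A φ x) fun x y =>
    dist_sem_le_logicalDist A φ x y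

/-- Logical distance from a point is approximated from below by formulas, on finite sets. -/
theorem exists_formula_approx (A : Endofunctor.Coalgebra F) (z : logicalSpace Λ A)
    {S : Set (logicalSpace Λ A)} (hS : S.Finite) {ε : ℝ} (hε : 0 < ε) :
    ∃ φ : Formula Λ, (∀ x, (semLogical A φ x : ℝ) ≤ dist x z) ∧
      ∀ x ∈ S, dist x z - ε ≤ semLogical A φ x := by
  induction S, hS using Set.Finite.induction_on with
  | empty => exact ⟨.top, fun x => dist_nonneg, by simp⟩
  | @insert a S _ _ ih =>
    obtain ⟨φ, h₁, h₂⟩ := ih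
    obtain ⟨ψ, hψ⟩ : ∃ ψ : Formula Λ, dist a z - ε < dist (sem A ψ a) (sem A ψ z) :=
      exists_lt_of_lt_ciSup (show dist a z - ε < logicalDist Λ A a z from sub_lt_self _ hε)
    have e : ∀ x, (semLogical A (.and φ (.homs (sem A ψ z) ψ)) x : ℝ) =
        max (semLogical A φ x : ℝ) (dist (sem A ψ x) (sem A ψ z)) := by
      intro x
      rw [dist_comm]
      exact Monotone.map_max (Subtype.mono_coe _)
    -- `homs` turns `ψ` into its distance from its value at `z`, which never exceeds logical
    -- distance; conjunction is the maximum, so earlier lower bounds survive.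
    refine ⟨.and φ (.homs (sem A ψ z) ψ), fun x => ?_, ?_⟩
    · rw [e]
      exact max_le (h₁ x) (dist_sem_le_logicalDist A ψ x z)
    · rintro x (rfl | hx) <;> rw [e]
      · exact hψ.le.trans (le_max_right _ _)
      · exact (h₂ x hx).trans (le_max_left _ _)

end Semantics

/-! ### Finite approximation and descent of the structure map -/

section Functor

variable {F : BPMet.{u} ⥤ BPMet.{u}}

theorem LocallyNonexpansive.dist_map_le (hloc : LocallyNonexpansive F) {X Y : BPMet.{u}}
    (f g : X ⟶ Y) {ε : ℝ} (hε : 0 ≤ ε) (h : ∀ x, dist (f x) (g x) ≤ ε) (t : F.obj X) :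
    dist (F.map f t) (F.map g t) ≤ ε := by
  -- `hε` covers empty `X`, where the supremum is `0`.
  refine le_trans ?_ ((hloc X Y f g).trans (Real.iSup_le h hε))
  exact le_ciSup (f := fun t => dist (F.map f t) (F.map g t))
    ⟨1, by rintro _ ⟨s, rfl⟩; exact (F.obj Y).dist_le_one _ _⟩ t

/-- Elements of `F X` are approximated by elements of `F S` for finite subspaces `S`. -/
theorem HasDenseOmegaBoundedSubfunctor.exists_approx (hdense : HasDenseOmegaBoundedSubfunctor F)
    {X : BPMet.{u}} (t : F.obj X) {ε : ℝ} (hε : 0 < ε) :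
    ∃ S : Set X, S.Finite ∧ ∃ t' : F.obj (X.sub S), dist t (F.map (X.incl S) t') < ε := by
  obtain ⟨F₀, ι, -, hd, hb⟩ := hdense
  obtain ⟨t₀, h₀⟩ := (hd X).exists_dist_lt t hε
  obtain ⟨S, hS, t₁, rfl⟩ := hb X t₀
  refine ⟨S, hS, ι.app _ t₁, ?_⟩
  have e : ι.app X (F₀.map (X.incl S) t₁) = F.map (X.incl S) (ι.app _ t₁) :=
    congrArg (fun g : F₀.obj (X.sub S) ⟶ F.obj X => g t₁) (ι.naturality (X.incl S))
  rwa [← e]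

theorem exists_map_incl_of_subset {X : BPMet.{u}} {S T : Set X} (h : S ⊆ T)
    (t : F.obj (X.sub S)) : ∃ t' : F.obj (X.sub T), F.map (X.incl T) t' = F.map (X.incl S) t := by
  let j : X.sub S ⟶ X.sub T :=
    NonexpMap.ofDist (X := X.sub S) (Y := X.sub T) (Set.inclusion h) fun _ _ => le_rfl
  exact ⟨F.map j t, (map_comp_apply F j (X.incl T) t).symm⟩

/-- Two elements that are close to the image of a finite subspace `S` have almost the same
distance after applying a map that is close, on `S`, to an isometric embedding of `S`. -/
theorem dist_le_dist_map_add (hiso : PreservesIsometries F) (hloc : LocallyNonexpansive F)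
    {X Y : BPMet.{u}} {S : Set X} (f : X ⟶ Y) (k : X.sub S ⟶ Y) (hk : Isometry k) {ε : ℝ}
    (hε : 0 ≤ ε) (hfk : ∀ x : X.sub S, dist (f (X.incl S x)) (k x) ≤ ε) {t s : F.obj X}
    {t' s' : F.obj (X.sub S)} (ht : dist t (F.map (X.incl S) t') ≤ ε)
    (hs : dist s (F.map (X.incl S) s') ≤ ε) :
    dist t s ≤ dist (F.map f t) (F.map f s) + 6 * ε := by
  have key : ∀ {r : F.obj X} {r' : F.obj (X.sub S)}, dist r (F.map (X.incl S) r') ≤ ε →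
      dist (F.map f r) (F.map k r') ≤ 2 * ε := by
    intro r r' hr
    have h₁ := (hom_dist_le (F.map f) r (F.map (X.incl S) r')).trans hr
    have h₂ := hloc.dist_map_le (X.incl S ≫ f) k hε hfk r'
    rw [map_comp_apply] at h₂
    linarith [dist_triangle (F.map f r) (F.map f (F.map (X.incl S) r')) (F.map k r')]
  have h₁ := key ht
  have h₂ := key hs
  have h₃ := (hiso _ _ k hk).dist_eq t' s'
  have h₄ := hom_dist_le (F.map (X.incl S)) t' s'
  have h₅ := dist_triangle4 t (F.map (X.incl S) t') (F.map (X.incl S) s') s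
  have h₆ := dist_triangle4 (F.map k t') (F.map f t) (F.map f s) (F.map k s')
  rw [dist_comm (F.map k t') (F.map f t)] at h₆
  rw [dist_comm (F.map (X.incl S) s') s] at h₅
  -- Replacing `t`, `s` by approximants costs `2 * ε`; passing from `k` to `f` costs `4 * ε`.
  linarith

/-- The embedding of a finite subspace into a cube by the distances from its points. -/
theorem isometry_tuple_distFrom {X : BPMet.{u}} {S : Set X} {n : ℕ} (p : Fin n → X.sub S)
    (hp : Function.Surjective p) :
    Isometry (toCube (NonexpMap.tuple fun i => distFrom (p i)) : X.sub S ⟶ cube.{u} n) := by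
  refine Isometry.of_dist_eq fun x y => le_antisymm (hom_dist_le _ x y) ?_
  -- The coordinate of `y` itself already attains the distance.
  obtain ⟨i, rfl⟩ := hp y
  refine le_trans ?_ (dist_le_pi_dist (fun j => distFrom (p j) x) (fun j => distFrom (p j) (p i)) i)
  change _ ≤ |dist x (p i) - dist (p i) (p i)|
  rw [dist_self, sub_zero]
  exact le_abs_self _

/-- If all predicate liftings are available, then the coalgebra structure descends to the state
space under logical distance. -/
theorem dist_map_str_le_logicalDist (hiso : PreservesIsometries F) (hloc : LocallyNonexpansive F)
    (hdense : HasDenseOmegaBoundedSubfunctor F) (A : Endofunctor.Coalgebra F) (x y : A.V) :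
    dist (F.map (toLogicalSpace Set.univ A) (A.str x))
      (F.map (toLogicalSpace Set.univ A) (A.str y)) ≤ logicalDist Set.univ A x y := by
  set L := logicalSpace Set.univ A with hL
  set q : A.V ⟶ L := toLogicalSpace Set.univ A
  set t := F.map q (A.str x) with ht
  set s := F.map q (A.str y) with hs
  refine le_of_forall_pos_le_add fun δ hδ => ?_
  have hε : 0 < δ / 6 := by positivity
  obtain ⟨S₁, hS₁, t₁, h₁⟩ := hdense.exists_approx t hε
  obtain ⟨S₂, hS₂, s₂, h₂⟩ := hdense.exists_approx s hε
  obtain ⟨t', et⟩ := exists_map_incl_of_subset (F := F) (Set.subset_union_left (t := S₂)) t₁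
  obtain ⟨s', es⟩ := exists_map_incl_of_subset (F := F) (Set.subset_union_right (s := S₁)) s₂
  rw [← et] at h₁
  rw [← es] at h₂
  have hS := hS₁.union hS₂
  generalize S₁ ∪ S₂ = S at hS t' s' et es h₁ h₂
  have : Finite S := hS
  obtain ⟨n, ⟨p⟩⟩ := Finite.exists_equiv_fin S
  choose φ hφ₁ hφ₂ using fun i : Fin n =>
    exists_formula_approx (Λ := Set.univ) A (p.symm i).1 hS hε
  let f : L ⟶ cube.{u} n := toCube (NonexpMap.tuple fun i => semLogical A (φ i))
  have hfk : ∀ i (x : L.sub S),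
      |(semLogical A (φ i) x.1 : ℝ) - dist (α := L) x.1 (p.symm i).1| ≤ δ / 6 := fun i x =>
    abs_le.2 ⟨by linarith [hφ₂ i x.1 x.2], by linarith [hφ₁ i x.1]⟩
  have hd := dist_le_dist_map_add hiso hloc f _
    (isometry_tuple_distFrom (X := L) (S := S) p.symm p.symm.surjective) hε.le
    (fun x => (dist_pi_le_iff hε.le).2 fun i => hfk i x) h₁.le h₂.le
  -- Measures the distance to `F.map f t`, so it vanishes at `x`, and its value at `y` is the
  -- distance sought.
  let ψ : Formula (Set.univ : Set (PredicateLifting F)) :=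
    .modal (.ofPred F n (distFrom (F.map f t))) trivial φ
  have hψ : ∀ z : A.V, (sem A ψ z : ℝ) = dist (F.map f (F.map q (A.str z))) (F.map f t) := by
    intro z
    rw [← map_comp_apply]
    rfl
  have hle := dist_sem_le_logicalDist A ψ x y
  rw [Subtype.dist_eq, Real.dist_eq, hψ, hψ, ← ht, ← hs, dist_self, zero_sub, abs_neg,
    abs_of_nonneg dist_nonneg, dist_comm] at hle
  linarith

/-- The logic over all predicate liftings of finite arity is expressive. -/
theorem expressive_univ (hiso : PreservesIsometries F) (hloc : LocallyNonexpansive F)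
    (hdense : HasDenseOmegaBoundedSubfunctor F) :
    Expressive (Set.univ : Set (PredicateLifting F)) := by
  intro A x y
  refine le_antisymm (logicalDist_le_behaviouralDist _ A x y) ?_
  let q := toLogicalSpace Set.univ A
  let B : Endofunctor.Coalgebra F :=
    { V := logicalSpace Set.univ A
      str := NonexpMap.ofDist (X := logicalSpace Set.univ A) (fun z => F.map q (A.str z))
        (dist_map_str_le_logicalDist hiso hloc hdense A) }
  let g : A ⟶ B := { f := q, h := rfl }
  exact csInf_le ⟨0, by rintro _ ⟨_, _, rfl⟩; exact dist_nonneg⟩ ⟨B, g, rfl⟩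

end Functor

end

theorem mainTheorem4 (F : BPMet.{u} ⥤ BPMet.{u})
    (hiso : PreservesIsometries F)
    (hloc : LocallyNonexpansive F)
    (hdense : HasDenseOmegaBoundedSubfunctor F) :
    ∃ Λ : Set (PredicateLifting F), Small.{u} Λ ∧ Expressive Λ :=
  ⟨Set.univ, inferInstance, expressive_univ hiso hloc hdense⟩
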